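/- Let $K$ be a field with $\operatorname{char} K = 2$. For a finite group $G$ and a faithful representation $\rho : G \to GL(V)$ on a finite-dimensional $K$-vector space $V$, let $K(V)$ be the field of rational functions on $V$ (the fraction field of the symmetric algebra of the dual space $V^*$), on which $G$ acts by $K$-automorphisms. A faithful $G$-subfield of $K(V)$ is a field $E$ with $K \subseteq E \subseteq K(V)$ that is stable under $G$ and on which only the identity of $G$ acts trivially. Put $$\operatorname{ed}_K(G) = \min\{\operatorname{trdeg}_K E : E \text{ is a faithful } G\text{-subfield of } K(V)\};$$ this number does not depend on the choice of the faithful representation $\rho$. Let $A_4$ and $A_5$ be the alternating groups on $4$ and $5$ letters, and $\mathbf{F}_4$ the field with four elements. Then, for every choice of faithful finite-dimensional representations of $A_4$ and $A_5$ over $K$ used to compute these numbers: (1) If $K \supseteq \mathbf{F}_4$, then $\operatorname{ed}_K(A_4) = \operatorname{ed}_K(A_5) = 1$. (2) If $K$ does not contain $\mathbf{F}_4$, then $\operatorname{ed}_K(A_4) = \operatorname{ed}_K(A_5) = 2$. -/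

import Mathlib

namespace EssDim

universe u v w

noncomputable section

variable (K : Type u) [Field K] (V : Type v) [AddCommGroup V] [Module K V]

/-- The ring `K[V]` of polynomial functions: the symmetric algebra of the dual space of `V`. -/
abbrev PolyRing : Type (max u v) := SymmetricAlgebra K (Module.Dual K V)

/-- The field `K(V)` of rational functions on `V`. -/
abbrev FunField : Type (max u v) := FractionRing (PolyRing K V)

variable {K V} {G : Type w} [Group G] (ρ : Representation K G V)

/-- The action on `K[V]`, induced by the contragredient action `(g • f)(x) = f (g⁻¹ x)`
on linear forms. -/
def polyHom : G →* (PolyRing K V →ₐ[K] PolyRing K V) where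
  toFun g := SymmetricAlgebra.lift (SymmetricAlgebra.ι K (Module.Dual K V) ∘ₗ ρ.dual g)
  map_one' := by
    apply SymmetricAlgebra.algHom_ext
    ext f
    rw [map_one]
    simp
  map_mul' g h := by
    apply SymmetricAlgebra.algHom_ext
    ext f
    rw [map_mul]
    simp

/-- The action of `G` on `K[V]` by `K`-algebra automorphisms. -/
def polyAut : G →* (PolyRing K V ≃ₐ[K] PolyRing K V) :=
  (AlgEquiv.algHomUnitsEquiv K (PolyRing K V)).toMonoidHom.comp (polyHom ρ).toHomUnits

/-- The action of `G` on `K(V)` by `K`-automorphisms which extends the one on `K[V]`. -/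
def fieldAut : G →* (FunField K V ≃ₐ[K] FunField K V) :=
  (IsFractionRing.fieldEquivOfAlgEquivHom K (FunField K V)).comp (polyAut ρ)

theorem fieldAut_ι (g : G) (f : Module.Dual K V) :
    fieldAut ρ g (algebraMap (PolyRing K V) (FunField K V)
        (SymmetricAlgebra.ι K (Module.Dual K V) f)) =
      algebraMap (PolyRing K V) (FunField K V)
        (SymmetricAlgebra.ι K (Module.Dual K V) (ρ.dual g f)) := by
  simp [fieldAut, polyAut, polyHom]

/-- An intermediate field `K ⊆ E ⊆ K(V)` is a faithful `G`-subfield of `K(V)` if it is stable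
under `G` and only the identity of `G` acts trivially on it. -/
structure IsFaithfulSubfield (E : IntermediateField K (FunField K V)) : Prop where
  stable : ∀ g : G, ∀ x ∈ E, fieldAut ρ g x ∈ E
  faithful : ∀ g : G, (∀ x ∈ E, fieldAut ρ g x = x) → g = 1

/-- The essential dimension computed from the representation `ρ`: the least transcendence degree
over `K` of a faithful `G`-subfield of `K(V)`. If `ρ` is injective then `K(V)` itself is such a
subfield, and the infimum of a nonempty set of cardinals is attained. -/
def essDim : Cardinal.{max u v} :=
  sInf {d | ∃ E : IntermediateField K (FunField K V),
    IsFaithfulSubfield ρ E ∧ Algebra.trdeg K E = d}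

end

end EssDim

namespace EssDim

/-! Upper bounds. `SL₂(𝔽₄)` has order 60 and acts faithfully on the five points of `ℙ¹(𝔽₄)`, so it
is `A₅`; hence `A₄ ⊂ A₅ ⊂ SL₂(𝔽₄)`. If `K` contains `𝔽₄`, the normal basis theorem places a copy of
this two-dimensional representation inside `K(V)`. The ratio `t` of its two coordinates is moved by
fractional linear transformations, faithfully because a scalar matrix of determinant 1 is trivial in
characteristic 2; so `K(t)` is a faithful subfield (`exists_moebius_coordinate`). If `K` does not
contain `𝔽₄`, the same construction runs over `K(ω)`, with `ω` a cube root of unity, and `K(ω, t,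
t̄) ∩ K(V)` has transcendence degree at most 2.

Lower bounds. `K` is algebraically closed in `K(V)`, so degree 0 would force a trivial action.
Suppose `A₄` acts faithfully on a subfield of degree 1. A finitely generated stable subfield is
still faithful, embeds in `K(X)` by Kronecker substitution, and is therefore isomorphic to `K(X)` by
Lüroth. Thus `A₄` embeds in `Aut K(X) = PGL₂(K)`, and a matrix computation
(`exists_cube_root_of_matrices`) extracts a primitive cube root of unity in `K`, that is, a copy of
`𝔽₄`. -/

/-! ### The embeddings of `A₄` and `A₅` in `SL₂(𝔽₄)`. -/

theorem smul_onePoint_eq_self {F : Type*} [Field F] [DecidableEq F] (g : Matrix.GeneralLinearGroup (Fin 2) F)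
    (h : ∀ x : OnePoint F, g • x = x) : g 0 1 = 0 ∧ g 1 0 = 0 ∧ g 0 0 = g 1 1 := by
  have h1 := OnePoint.smul_infty_eq_self_iff.1 (h OnePoint.infty)
  have h0 := Matrix.GeneralLinearGroup.fixpointPolynomial_aeval_eq_zero_iff.2 (h ((0 : F) : OnePoint F))
  have h2 := Matrix.GeneralLinearGroup.fixpointPolynomial_aeval_eq_zero_iff.2 (h ((1 : F) : OnePoint F))
  simp [Matrix.GeneralLinearGroup.fixpointPolynomial, h1] at h0 h2
  refine ⟨h0, h1, ?_⟩
  rw [h0] at h2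
  linear_combination -h2

theorem specialLinearGroup_eq_one {F : Type*} [Field F] [CharP F 2]
    {g : Matrix.SpecialLinearGroup (Fin 2) F} (h1 : g 0 1 = 0) (h2 : g 1 0 = 0)
    (h3 : g 0 0 = g 1 1) : g = 1 := by
  have hd := g.det_coe
  rw [Matrix.det_fin_two, h1, h2, ← h3] at hd
  have h4 : g 0 0 = 1 := by
    have : (g 0 0 - 1) ^ 2 = 0 := by
      rw [sub_sq, one_pow]
      linear_combination hd + (1 - g 0 0) * CharTwo.two_eq_zero (R := F)
    exact sub_eq_zero.1 (pow_eq_zero_iff two_ne_zero |>.1 this)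
  ext i j
  fin_cases i <;> fin_cases j <;> simp [h1, h2, ← h3, h4]

/-- The action of `SL₂` on the projective line. -/
noncomputable def slPerm (F : Type*) [Field F] [DecidableEq F] :
    Matrix.SpecialLinearGroup (Fin 2) F →* Equiv.Perm (OnePoint F) :=
  (MulAction.toPermHom (Matrix.GeneralLinearGroup (Fin 2) F) (OnePoint F)).comp
    Matrix.SpecialLinearGroup.toGL

theorem slPerm_injective (F : Type*) [Field F] [DecidableEq F] [CharP F 2] :
    Function.Injective (slPerm F) := by
  rw [injective_iff_map_eq_one]
  intro g hg
  obtain ⟨h1, h2, h3⟩ := smul_onePoint_eq_self (Matrix.SpecialLinearGroup.toGL g)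
    fun x => congrArg (fun e : Equiv.Perm (OnePoint F) => e x) hg
  simp at h1 h2 h3
  exact specialLinearGroup_eq_one h1 h2 h3

theorem card_special_linear_two (F : Type*) [Field F] [Fintype F] :
    Nat.card (Matrix.SpecialLinearGroup (Fin 2) F) * (Fintype.card F - 1) =
      (Fintype.card F ^ 2 - 1) * (Fintype.card F ^ 2 - Fintype.card F) := by
  classical
  have h := Matrix.card_GL_field (𝔽 := F) 2
  rw [Fin.prod_univ_two] at h
  simp only [Fin.val_zero, pow_zero, Fin.val_one, pow_one] at h
  rw [← h]
  let d := Matrix.GeneralLinearGroup.det (n := Fin 2) (R := F)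
  have hs : Function.Surjective d := by
    intro u
    refine ⟨Matrix.GeneralLinearGroup.mkOfDetNeZero !![(u : F), 0; 0, 1] (by simp), ?_⟩
    ext
    simp [d, Matrix.GeneralLinearGroup.mkOfDetNeZero]
  have hk : d.ker = (Matrix.SpecialLinearGroup.toGL (n := Fin 2) (R := F)).range := by
    ext g
    constructor
    · intro hg
      refine ⟨⟨g, ?_⟩, ?_⟩
      · simpa [d, Units.ext_iff] using hg
      · ext; rfl
    · rintro ⟨g, rfl⟩
      ext
      simp [d]
  have h1 := Subgroup.card_mul_index d.ker
  rw [Subgroup.index_ker, MonoidHom.range_eq_top.2 hs, hk] at h1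
  have h2 : Nat.card (Matrix.SpecialLinearGroup.toGL (n := Fin 2) (R := F)).range =
      Nat.card (Matrix.SpecialLinearGroup (Fin 2) F) :=
    (Nat.card_congr (MonoidHom.ofInjective Matrix.SpecialLinearGroup.toGL_injective).toEquiv).symm
  rw [h2] at h1
  rw [← h1]
  rw [Subgroup.card_top, Nat.card_units, Nat.card_eq_fintype_card (α := F)]

theorem exists_alternatingFive_hom : ∃ π : alternatingGroup (Fin 5) →*
    Matrix.SpecialLinearGroup (Fin 2) (GaloisField 2 2), Function.Injective π := by
  classical
  have : Fintype (GaloisField 2 2) := Fintype.ofFinite _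
  have hc : Fintype.card (GaloisField 2 2) = 4 := by
    rw [← Nat.card_eq_fintype_card, GaloisField.card 2 2 two_ne_zero]; rfl
  have hc5 : Fintype.card (OnePoint (GaloisField 2 2)) = Fintype.card (Fin 5) := by
    rw [Fintype.card_fin]
    exact (Fintype.card_option (α := GaloisField 2 2)).trans (by rw [hc])
  let e := Fintype.equivOfCardEq hc5
  let f := (e.permCongrHom.toMonoidHom).comp (slPerm (GaloisField 2 2))
  have hf : Function.Injective f := e.permCongrHom.injective.comp (slPerm_injective _)
  have h60 : Nat.card f.range = 60 := by
    rw [← Nat.card_congr (MonoidHom.ofInjective hf).toEquiv]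
    have := card_special_linear_two (GaloisField 2 2)
    rw [hc] at this
    omega
  have hi : f.range.index = 2 := by
    have := Subgroup.card_mul_index f.range
    rw [h60, Nat.card_perm] at this
    simp [Nat.factorial] at this
    omega
  -- The alternating group is the only subgroup of index 2 in `S₅`.
  have hr := Equiv.Perm.eq_alternatingGroup_of_index_eq_two hi
  let g := (MonoidHom.ofInjective hf).trans (MulEquiv.subgroupCongr hr)
  exact ⟨g.symm.toMonoidHom, g.symm.injective⟩

theorem exists_alternatingFour_hom : ∃ f : alternatingGroup (Fin 4) →*
    alternatingGroup (Fin 5), Function.Injective f := by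
  classical
  let i : Fin 4 ↪ Fin 5 := Fin.castSuccEmb
  let φ : Equiv.Perm (Fin 4) →* Equiv.Perm (Fin 5) := Equiv.Perm.viaEmbeddingHom i
  have hφ : ∀ σ, Equiv.Perm.sign (φ σ) = Equiv.Perm.sign σ := by
    intro σ
    have : φ σ = σ.viaFintypeEmbedding i := by
      ext x
      by_cases hx : x ∈ Set.range i
      · obtain ⟨y, rfl⟩ := hx
        rw [Equiv.Perm.viaFintypeEmbedding_apply_image]
        exact congrArg _ (Equiv.Perm.viaEmbedding_apply σ i y)
      · rw [Equiv.Perm.viaFintypeEmbedding_apply_notMem_range _ _ hx]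
        exact congrArg _ (Equiv.Perm.viaEmbedding_apply_of_notMem σ i x hx)
    rw [this, Equiv.Perm.viaFintypeEmbedding_sign]
  refine ⟨(φ.comp (alternatingGroup (Fin 4)).subtype).codRestrict (alternatingGroup (Fin 5)) ?_, ?_⟩
  · intro x
    rw [Equiv.Perm.mem_alternatingGroup]
    exact (hφ x).trans (Equiv.Perm.mem_alternatingGroup.1 x.2)
  · intro x y h
    exact Subtype.ext (Equiv.Perm.viaEmbeddingHom_injective i (congrArg Subtype.val h))

/-! ### Cube roots of unity and copies of `𝔽₄`. -/

section CubeRoots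

open Polynomial

variable {K : Type*} [Field K] [CharP K 2]

/-- `GaloisField 2 2` is the splitting field of `X⁴ - X`, whose roots in `K` are `0, 1, r, r + 1`.
-/
theorem nonempty_galoisField_hom {r : K} (hr : r ^ 2 + r + 1 = 0) :
    Nonempty (GaloisField 2 2 →+* K) := by
  let _ : Algebra (ZMod 2) K := ZMod.algebra K 2
  have h2 := CharTwo.two_eq_zero (R := K)
  have h : ((X ^ 2 ^ 2 - X : (ZMod 2)[X]).map (algebraMap (ZMod 2) K)) =
      X * (X - C 1) * (X - C r) * (X - C (r + 1)) := by
    have h2' : (2 : K[X]) = 0 := by rw [← C_ofNat, h2, C_0]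
    have hr' : C r ^ 2 + C r + 1 = (0 : K[X]) := by
      rw [← C_1, ← C_pow, ← C_add, ← C_add, hr, C_0]
    simp only [Polynomial.map_sub, Polynomial.map_pow, map_X, C_add, C_1]
    generalize C r = s at hr' ⊢
    linear_combination (X - X ^ 2) * hr' + (X ^ 3 - X - X ^ 2 * s + X ^ 3 * s) * h2'
  have hs : ((X ^ 2 ^ 2 - X : (ZMod 2)[X]).map (algebraMap (ZMod 2) K)).Splits := by
    rw [h]
    exact (((Splits.X).mul (Splits.X_sub_C _)).mul (Splits.X_sub_C _)).mul (Splits.X_sub_C _)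
  exact ⟨(SplittingField.lift (X ^ 2 ^ 2 - X : (ZMod 2)[X]) hs).toRingHom⟩

end CubeRoots

/-! ### The matrix relations of `A₄` in `PGL₂(K)`. -/

section Matrices

open Matrix

variable {K : Type*} [Field K] [CharP K 2]

/-- The off-diagonal entries of `A²` are those of `A` times the trace. If the trace were nonzero,
`A` would be diagonal with entries of equal square, and in characteristic 2 these coincide. -/
theorem diag_eq_of_mul_self {A : Matrix (Fin 2) (Fin 2) K} {α : K}
    (h : A * A = α • 1) : A 0 0 = A 1 1 := by
  have h2 := CharTwo.two_eq_zero (R := K)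
  have h01 := congrFun (congrFun h 0) 1
  have h10 := congrFun (congrFun h 1) 0
  have h00 := congrFun (congrFun h 0) 0
  have h11 := congrFun (congrFun h 1) 1
  simp [mul_apply, Fin.sum_univ_two] at h01 h10 h00 h11
  by_contra hne
  have hs : A 0 0 + A 1 1 ≠ 0 := fun h0 => hne (by linear_combination h0 - A 1 1 * h2)
  have h3 : A 0 1 = 0 := by
    refine (mul_eq_zero.1 (?_ : (A 0 0 + A 1 1) * A 0 1 = 0)).resolve_left hs
    linear_combination h01
  have h4 : A 1 0 = 0 := by
    refine (mul_eq_zero.1 (?_ : (A 0 0 + A 1 1) * A 1 0 = 0)).resolve_left hs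
    linear_combination h10
  rw [h3, h4] at h00 h11
  refine hs (pow_eq_zero_iff two_ne_zero |>.1 ?_)
  linear_combination h00 - h11 + (A 1 1 ^ 2 + A 0 0 * A 1 1) * h2

/-- Lifts of the Klein four-group and a 3-cycle from `PGL₂(K)`. That `A`, `B` and `AB` all have
trace zero forces `B = p + qA`. Conjugation by `S` sends `B` to `uA` and `AB` to `wB`; comparing
coefficients of `1` and `A` gives `u² + uq + q² = 0`, so `u / q` is the required root. -/
theorem exists_cube_root_of_matrices {A B S : Matrix (Fin 2) (Fin 2) K} {α β γ u w : K}
    (hA : A * A = α • 1) (hB : B * B = β • 1) (hAB : (A * B) * (A * B) = γ • 1)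
    (nA : ∀ c : K, A ≠ c • 1) (nB : ∀ c : K, B ≠ c • 1) (nAB : ∀ c : K, A * B ≠ c • 1)
    (hS : S.det ≠ 0) (hu : u ≠ 0)
    (h1 : S * B = u • (A * S)) (h2 : S * (A * B) = w • (B * S)) :
    ∃ r : K, r ^ 2 + r + 1 = 0 := by
  have h20 := CharTwo.two_eq_zero (R := K)
  have dA := diag_eq_of_mul_self hA
  have dB := diag_eq_of_mul_self hB
  have dAB := diag_eq_of_mul_self hAB
  simp only [mul_apply, Fin.sum_univ_two] at dAB
  -- `B` is an affine function of `A`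
  obtain ⟨p, q, rfl⟩ : ∃ p q : K, B = p • 1 + q • A := by
    have key : A 0 1 * B 1 0 = A 1 0 * B 0 1 := by
      rw [dA, dB] at dAB; linear_combination dAB
    by_cases h : A 0 1 = 0
    · have h' : A 1 0 ≠ 0 := by
        intro h'
        refine nA (A 1 1) ?_
        ext i j; fin_cases i <;> fin_cases j <;> simp [h, h', dA]
      have hb : B 0 1 = 0 := by simpa [h, h'] using key
      refine ⟨B 1 1 - B 1 0 / A 1 0 * A 1 1, B 1 0 / A 1 0, ?_⟩
      ext i j; fin_cases i <;> fin_cases j <;> simp [h, h', dA, dB, hb]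
    · refine ⟨B 1 1 - B 0 1 / A 0 1 * A 1 1, B 0 1 / A 0 1, ?_⟩
      ext i j; fin_cases i <;> fin_cases j <;> simp [h, dA, dB]
      field_simp; linear_combination key
  have hAA : ∀ a b : K, a • 1 + b • A = 0 → a = 0 ∧ b = 0 := by
    intro a b h
    have hb : b = 0 := by
      by_contra hb
      refine nA (-(a / b)) ?_
      have : A = b⁻¹ • (b • A) := by rw [smul_smul, inv_mul_cancel₀ hb, one_smul]
      rw [this, eq_neg_of_add_eq_zero_right h]
      module
    subst hb
    simpa using congrFun (congrFun h 0) 0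
  have hq : q ≠ 0 := by
    rintro rfl
    exact nB p (by simp)
  have hp : p ≠ 0 := by
    rintro rfl
    refine nAB (q * α) ?_
    rw [zero_smul, zero_add, mul_smul_comm, hA, smul_smul]
  have hS' : ∀ X : Matrix (Fin 2) (Fin 2) K, X * S = 0 → X = 0 := by
    intro X hX
    have := congrArg (· * S⁻¹) hX
    simpa [Matrix.mul_assoc, Matrix.mul_nonsing_inv S (isUnit_iff_ne_zero.2 hS)] using this
  simp only [Matrix.mul_add, mul_smul_comm, mul_one, hA, add_mul, smul_mul_assoc, one_mul] at h1 h2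
  have e1 : q • (S * A) = u • (A * S) - p • S := eq_sub_of_add_eq' h1
  -- Eliminate `SA` from `h2` by means of `e1`.
  have e3 : (q * (q * α) - p * p - q * w * p) • (1 : Matrix (Fin 2) (Fin 2) K) +
      (p * u - q * w * q) • A = 0 := by
    apply hS'
    simp only [add_mul, smul_mul_assoc, one_mul]
    linear_combination (norm := module) q • h2 - p • e1
  -- Compute `q² S A² = q² α S` a second way, moving `A` past `S` twice with `e1`.
  have e4 : (u * u * α + p * p - q * q * α) • (1 : Matrix (Fin 2) (Fin 2) K) +
      (-(2 * u * p)) • A = 0 := by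
    apply hS'
    simp only [add_mul, smul_mul_assoc, one_mul]
    have h3 := congrArg (fun M => q • (M * A)) e1
    have h4 := congrArg (fun M => A * M) e1
    simp only [sub_mul, smul_mul_assoc, Matrix.mul_assoc, hA, mul_smul_comm, mul_one] at h3
    simp only [Matrix.mul_sub, mul_smul_comm, ← Matrix.mul_assoc, hA, smul_mul_assoc, one_mul] at h4
    rw [← Matrix.mul_assoc] at h3
    linear_combination (norm := module) - h3 - u • h4 + p • e1
  obtain ⟨e5, e6⟩ := hAA _ _ e3
  obtain ⟨e7, -⟩ := hAA _ _ e4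
  have hα : α * u * q = p * p := by
    have : u * (α * u * q - p * p) = 0 := by
      linear_combination q * e7 + q * e5 - p * e6
    simpa [hu, sub_eq_zero] using this
  have hα0 : α ≠ 0 := by
    rintro rfl
    simp [hp] at hα
  have h5 : α * (u ^ 2 + u * q + q ^ 2) = 0 := by
    linear_combination e7 + hα + q ^ 2 * α * h20
  have h6 := (mul_eq_zero.1 h5).resolve_left hα0
  refine ⟨u / q, ?_⟩
  field_simp
  linear_combination h6

end Matrices
-- `K` is algebraically closed in `K(V)`.
section RationalFunctions

variable {K : Type*} [Field K]

/-- The polynomial ring is integrally closed, so an algebraic element is a polynomial; if nonzero,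
it satisfies a relation with nonzero constant term, hence is a unit, hence a constant. -/
theorem mem_range_of_isAlgebraic_fractionRing {n : ℕ} {x : FractionRing (MvPolynomial (Fin n) K)}
    (hx : IsAlgebraic K x) : x ∈ (algebraMap K (FractionRing (MvPolynomial (Fin n) K))).range := by
  have hi : IsIntegral (MvPolynomial (Fin n) K) x := hx.isIntegral.tower_top
  obtain ⟨p, rfl⟩ := IsIntegrallyClosed.isIntegral_iff.1 hi
  have hinj := IsFractionRing.injective (MvPolynomial (Fin n) K)
    (FractionRing (MvPolynomial (Fin n) K))
  by_cases hp : p = 0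
  · exact ⟨0, by simp [hp]⟩
  have ha : IsAlgebraic K p := (isAlgebraic_algebraMap_iff hinj).1 hx
  obtain ⟨q, hq0, hq⟩ := ha.exists_nonzero_coeff_and_aeval_eq_zero (mem_nonZeroDivisors_of_ne_zero hp)
  have hu : IsUnit p := by
    rw [← Polynomial.divX_mul_X_add q] at hq
    simp only [map_add, map_mul, Polynomial.aeval_X, Polynomial.aeval_C] at hq
    have hc : IsUnit (algebraMap K (MvPolynomial (Fin n) K) (q.coeff 0)) :=
      (isUnit_iff_ne_zero.2 hq0).map _
    rw [← neg_eq_iff_add_eq_zero] at hq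
    rw [← hq, ← neg_mul] at hc
    exact isUnit_of_mul_isUnit_right hc
  obtain ⟨r, -, rfl⟩ := MvPolynomial.isUnit_iff_eq_C_of_isReduced.1 hu
  exact ⟨r, rfl⟩

/-- Coordinates identify `K(V)` with a field of rational functions in `dim V` variables. -/
theorem nonempty_funField_equiv (V : Type*) [AddCommGroup V] [Module K V] [FiniteDimensional K V] :
    ∃ n : ℕ, Nonempty (FunField K V ≃ₐ[K] FractionRing (MvPolynomial (Fin n) K)) :=
  ⟨_, ⟨IsFractionRing.fieldEquivOfAlgEquiv K (FunField K V) (FractionRing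
    (MvPolynomial (Fin (Module.finrank K (Module.Dual K V))) K))
    (SymmetricAlgebra.equivMvPolynomial (Module.finBasis K (Module.Dual K V)))⟩⟩

theorem mem_range_of_isAlgebraic {V : Type*} [AddCommGroup V] [Module K V] [FiniteDimensional K V]
    {x : FunField K V} (hx : IsAlgebraic K x) : x ∈ (algebraMap K (FunField K V)).range := by
  obtain ⟨n, ⟨e⟩⟩ := nonempty_funField_equiv (K := K) V
  obtain ⟨r, hr⟩ := mem_range_of_isAlgebraic_fractionRing (hx.algHom e.toAlgHom)
  refine ⟨r, e.injective ?_⟩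
  rw [AlgEquiv.commutes]
  exact hr

end RationalFunctions

/-! ### The action on `K(V)` and general bounds on essential dimension. -/

section Action

variable {K V G : Type*} [Field K] [AddCommGroup V] [Module K V] [Group G]

theorem fieldAut_injective {ρ : Representation K G V} [FiniteDimensional K V]
    (hρ : Function.Injective ρ) : Function.Injective (fieldAut ρ) := by
  rw [injective_iff_map_eq_one]
  intro g hg
  have h1 : ∀ f, ρ.dual g f = f := by
    intro f
    have h := fieldAut_ι ρ g f
    rw [hg, AlgEquiv.one_apply] at h
    have h' := IsFractionRing.injective (PolyRing K V) (FunField K V) h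
    have hi : Function.Injective (SymmetricAlgebra.ι K (Module.Dual K V)) := by
      intro a b hab
      let B := Module.finBasis K (Module.Dual K V)
      have h2 : ∀ f, SymmetricAlgebra.equivMvPolynomial B (SymmetricAlgebra.ι K _ f) =
          ∑ i, B.repr f i • MvPolynomial.X i := by
        intro f
        conv_lhs => rw [← B.sum_repr f]
        simp only [map_sum, map_smul, SymmetricAlgebra.equivMvPolynomial_ι_apply]
      have h3 := congrArg (SymmetricAlgebra.equivMvPolynomial B) hab
      rw [h2, h2] at h3
      apply B.ext_elem
      intro i
      have h4 := congrArg (MvPolynomial.coeff (Finsupp.single i 1)) h3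
      simpa [MvPolynomial.coeff_sum, MvPolynomial.coeff_X, Finsupp.single_left_inj] using h4
    exact (hi h').symm
  have h2 : ρ g⁻¹ = 1 := by
    ext v
    rw [← sub_eq_zero, ← Module.forall_dual_apply_eq_zero_iff K]
    intro f
    have := LinearMap.congr_fun (h1 f) v
    rw [Representation.dual_apply] at this
    simpa [sub_eq_zero, Module.Dual.transpose_apply] using this
  rw [← map_one ρ] at h2
  exact inv_eq_one.1 (hρ h2)

theorem essDim_eq {ρ : Representation K G V} (c : ℕ)
    (h1 : ∃ E, IsFaithfulSubfield ρ E ∧ Algebra.trdeg K E ≤ c)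
    (h2 : ∀ E, IsFaithfulSubfield ρ E → c ≤ Algebra.trdeg K E) : essDim ρ = c := by
  obtain ⟨E, hE, hc⟩ := h1
  have hmem : Algebra.trdeg K E ∈ {d | ∃ E : IntermediateField K (FunField K V),
    IsFaithfulSubfield ρ E ∧ Algebra.trdeg K E = d} := ⟨E, hE, rfl⟩
  refine le_antisymm ((csInf_le' hmem).trans hc) (le_csInf ⟨_, E, hE, rfl⟩ ?_)
  rintro d ⟨E', hE', rfl⟩
  exact h2 E' hE'

theorem one_le_trdeg [FiniteDimensional K V] [Nontrivial G] {ρ : Representation K G V}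
    {E : IntermediateField K (FunField K V)} (hE : IsFaithfulSubfield ρ E) :
    1 ≤ Algebra.trdeg K E := by
  rw [Cardinal.one_le_iff_ne_zero]
  intro h0
  have h := (trdeg_eq_zero_iff (R := K) (A := E)).1 h0
  obtain ⟨g, hg⟩ := exists_ne (1 : G)
  refine hg (hE.faithful g fun x hx => ?_)
  obtain ⟨r, rfl⟩ := mem_range_of_isAlgebraic
    ((Algebra.IsAlgebraic.isAlgebraic (R := K) (⟨x, hx⟩ : E)).algHom E.val)
  exact AlgEquiv.commutes _ _

/-- A finite group of automorphisms of a field over `K` has an orbit that is linearly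
independent over `K`. -/
theorem exists_linearIndependent_orbit {L : Type*} [Field L] [Algebra K L] [Finite G]
    (σ : G →* (L ≃ₐ[K] L)) (hσ : Function.Injective σ) :
    ∃ x : L, LinearIndependent K fun g => σ g x := by
  classical
  have := Fintype.ofFinite G
  let _ : MulSemiringAction G L := MulSemiringAction.compHom L σ
  have hsm : ∀ (g : G) (y : L), g • y = σ g y := fun _ _ => rfl
  -- Normal basis theorem over the fixed field, which contains `K`.
  obtain ⟨x, hx⟩ := exists_linearIndependent_algEquiv_apply (FixedPoints.subfield G L) L
  let τ := MulSemiringAction.toAlgAut G (FixedPoints.subfield G L) L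
  have hτ : Function.Injective τ := fun g h hgh => hσ (AlgEquiv.ext fun y =>
    congrArg (fun e : L ≃ₐ[FixedPoints.subfield G L] L => e y) hgh)
  have hx' := hx.comp τ hτ
  refine ⟨x, Fintype.linearIndependent_iff.2 fun c hc g => ?_⟩
  have hmem : ∀ r : K, algebraMap K L r ∈ FixedPoints.subfield G L :=
    fun r g => (σ g).commutes r
  have h := Fintype.linearIndependent_iff.1 hx' (fun g => ⟨_, hmem (c g)⟩)
    (by rw [← hc]; exact Finset.sum_congr rfl fun g _ => (Algebra.smul_def (c g) _).symm) g
  exact (map_eq_zero (algebraMap K L)).1 (congrArg Subtype.val h)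

end Action
-- Faithful fractional linear actions from two-dimensional representations.
section Moebius

variable {k F G : Type*} [Field k] [Field F] [Group G]

/-- A nontrivial element of `SL₂` is not scalar in characteristic 2, so one of `(1,0)`, `(0,1)`,
`(1,1)` is not an eigenvector of it; that vector and its image are independent. -/
theorem exists_cyclic_vector [CharP k 2] [Nontrivial G]
    (π : G →* Matrix.SpecialLinearGroup (Fin 2) k) (hπ : Function.Injective π) :
    ∃ p : Fin 2 → k, ∀ l : Fin 2 → k,
      (∀ g, l ⬝ᵥ ((π g : Matrix (Fin 2) (Fin 2) k).mulVec p) = 0) → l = 0 := by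
  obtain ⟨g, hg⟩ := exists_ne (1 : G)
  have key : ∀ p : Fin 2 → k, p 0 * (π g 1 0 * p 0 + π g 1 1 * p 1) -
      p 1 * (π g 0 0 * p 0 + π g 0 1 * p 1) ≠ 0 → ∀ l : Fin 2 → k,
      (∀ g, l ⬝ᵥ ((π g : Matrix (Fin 2) (Fin 2) k).mulVec p) = 0) → l = 0 := by
    intro p hp l hl
    have h1 := hl 1
    have h2 := hl g
    simp [dotProduct, Matrix.mulVec, Fin.sum_univ_two] at h1 h2
    ext i
    fin_cases i
    · refine (mul_eq_zero.1 (?_ : _ * l 0 = 0)).resolve_left hp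
      linear_combination (π g 1 0 * p 0 + π g 1 1 * p 1) * h1 - p 1 * h2
    · refine (mul_eq_zero.1 (?_ : _ * l 1 = 0)).resolve_left hp
      linear_combination p 0 * h2 - (π g 0 0 * p 0 + π g 0 1 * p 1) * h1
  by_cases h10 : π g 1 0 = 0
  · by_cases h01 : π g 0 1 = 0
    · refine ⟨![1, 1], key _ ?_⟩
      intro h
      simp [h10, h01] at h
      apply hg
      exact hπ ((specialLinearGroup_eq_one h01 h10 (sub_eq_zero.1 h).symm).trans (map_one π).symm)
    · exact ⟨![0, 1], key _ (by simpa using h01)⟩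
  · exact ⟨![1, 0], key _ (by simpa using h10)⟩

/-- A two-dimensional representation of `G` of determinant `1` yields an element of `F` on which
`G` acts faithfully by fractional linear transformations. -/
theorem exists_moebius_coordinate [Finite G] [CharP k 2] [Nontrivial G] (f : k →+* F)
    (hquad : ∀ (x : F) (a b c : k), f a * x ^ 2 + f b * x + f c = 0 →
      ¬ (a = 0 ∧ b = 0 ∧ c = 0) → ∃ r, f r = x)
    (s : G → F →+* F) (hsf : ∀ g r, s g (f r) = f r)
    (y : G → F) (hsy : ∀ g h, s g (y h) = y (g * h))
    (hy : ∀ c : G → k, ∑ᶠ g, f (c g) * y g = 0 → ∀ g, c g = 0)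
    (π : G →* Matrix.SpecialLinearGroup (Fin 2) k) (hπ : Function.Injective π) :
    ∃ t : F, (∀ g, ∃ a b c d : k, s g t = (f a * t + f b) / (f c * t + f d)) ∧
      ∀ g, s g t = t → g = 1 := by
  classical
  have := Fintype.ofFinite G
  simp only [finsum_eq_sum_of_fintype] at hy
  obtain ⟨p, hp⟩ := exists_cyclic_vector π hπ
  let c : G → Fin 2 → k := fun g => (π g : Matrix (Fin 2) (Fin 2) k).mulVec p
  -- Since `y` is permuted like the regular representation, `G` acts on the pair `a` through the
  -- matrices `π g⁻¹`; the choice of `p` makes the pair independent over `k`.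
  let a : Fin 2 → F := fun i => ∑ g, f (c g i) * y g
  have hc : ∀ g h, c (g⁻¹ * h) = (π g⁻¹ : Matrix (Fin 2) (Fin 2) k).mulVec (c h) := by
    intro g h
    simp only [c, map_mul, Matrix.SpecialLinearGroup.coe_mul, Matrix.mulVec_mulVec]
  have hind : ∀ l0 l1 : k, f l0 * a 0 + f l1 * a 1 = 0 → l0 = 0 ∧ l1 = 0 := by
    intro l0 l1 h
    have h1 : ∑ g, f (l0 * c g 0 + l1 * c g 1) * y g = 0 := by
      rw [← h, Finset.mul_sum, Finset.mul_sum, ← Finset.sum_add_distrib]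
      refine Finset.sum_congr rfl fun g _ => ?_
      simp only [map_add, map_mul]
      ring
    have h2 := hp ![l0, l1] fun g => by
      simpa [dotProduct, Fin.sum_univ_two, c, Matrix.mulVec] using hy _ h1 g
    exact ⟨congrFun h2 0, congrFun h2 1⟩
  have ha1 : a 1 ≠ 0 := by
    intro h
    have := hind 0 1 (by simp [h])
    exact one_ne_zero this.2
  have hsa : ∀ g i, s g (a i) = f (π g⁻¹ i 0) * a 0 + f (π g⁻¹ i 1) * a 1 := by
    intro g i
    have h1 : s g (a i) = ∑ h, f (c (g⁻¹ * h) i) * y h := by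
      simp only [a, map_sum, map_mul, hsf, hsy]
      refine Fintype.sum_equiv (Equiv.mulLeft g) _ _ fun h => ?_
      simp
    rw [h1, Finset.mul_sum, Finset.mul_sum, ← Finset.sum_add_distrib]
    refine Finset.sum_congr rfl fun h _ => ?_
    rw [hc]
    simp only [Matrix.mulVec, dotProduct, Fin.sum_univ_two, map_add, map_mul]
    ring
  have hden : ∀ g, s g (a 1) ≠ 0 := fun g => by simpa using ha1
  refine ⟨a 0 / a 1, fun g => ⟨π g⁻¹ 0 0, π g⁻¹ 0 1, π g⁻¹ 1 0, π g⁻¹ 1 1, ?_⟩, fun g hg => ?_⟩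
  · have h1 := hden g
    rw [map_div₀, hsa g 0]
    rw [hsa g 1] at h1 ⊢
    field_simp
  · have h1 := hden g
    rw [map_div₀, div_eq_div_iff h1 ha1, hsa, hsa] at hg
    -- These are the coefficients of the quadratic equation expressing that `g` fixes `a 0 / a 1`.
    -- Were it nontrivial, `hquad` would put the ratio in `k`, against independence.
    have h2 : π g⁻¹ 1 0 = 0 ∧ π g⁻¹ 1 1 - π g⁻¹ 0 0 = 0 ∧ - π g⁻¹ 0 1 = 0 := by
      by_contra hne
      obtain ⟨r, hr⟩ := hquad (a 0 / a 1) _ _ _ (by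
        field_simp
        simp only [map_sub, map_neg]
        linear_combination -hg) hne
      have h3 := hind 1 (-r) (by
        rw [map_neg, hr]; field_simp; simp)
      exact one_ne_zero h3.1
    obtain ⟨h10, hd, h01⟩ := h2
    exact inv_eq_one.1 (hπ ((specialLinearGroup_eq_one (neg_eq_zero.1 h01) h10
      (sub_eq_zero.1 hd).symm).trans (map_one π).symm))

end Moebius

/-! ### Transcendence degree of generated subfields. -/

section TranscendenceDegree

universe u

open Cardinal IntermediateField

variable {K L : Type*} [Field K] [Field L] [Algebra K L]

open algebraAdjoinAdjoin in
theorem trdeg_adjoin_le (s : Set L) : Algebra.trdeg K (adjoin K s) ≤ #s := by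
  have h1 := trdeg_add_eq K (Algebra.adjoin K s) (A := adjoin K s)
  have : Algebra.IsAlgebraic (Algebra.adjoin K s) (adjoin K s) :=
    IsLocalization.isAlgebraic _ (nonZeroDivisors (Algebra.adjoin K s))
  rw [trdeg_eq_zero (R := Algebra.adjoin K s), add_zero] at h1
  rw [← h1]
  have h2 : Function.Surjective ((MvPolynomial.aeval (R := K) ((↑) : s → L)).rangeRestrict) :=
    AlgHom.rangeRestrict_surjective _
  rw [Algebra.adjoin_eq_range]
  have h3 := lift_trdeg_le_of_surjective _ h2
  rw [MvPolynomial.trdeg_of_isDomain] at h3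
  simpa using h3

theorem trdeg_algebraicClosure {K : Type*} (M L : Type u) [Field K] [Field M] [Field L]
    [Algebra K M] [Algebra K L] [Algebra M L] [IsScalarTower K M L] :
    Algebra.trdeg K (algebraicClosure M L) = Algebra.trdeg K M := by
  have h1 : Algebra.trdeg K M + Algebra.trdeg M (algebraicClosure M L) =
    Algebra.trdeg K (algebraicClosure M L) := trdeg_add_eq ..
  rw [← h1, trdeg_eq_zero (R := M), add_zero]

theorem trdeg_adjoin_le_of_isAlgebraic (s T : Set L)
    (h : ∀ x ∈ T, IsAlgebraic (adjoin K s) x) : Algebra.trdeg K (adjoin K T) ≤ #s := by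
  refine le_trans ?_ (trdeg_adjoin_le (K := K) s)
  rw [← trdeg_algebraicClosure (adjoin K s) L]
  have h2 : adjoin K T ≤ (algebraicClosure (adjoin K s) L).restrictScalars K :=
    adjoin_le_iff.2 fun x hx => mem_algebraicClosure_iff.2 (h x hx)
  exact trdeg_le_of_injective (inclusion h2) (inclusion_injective h2)

end TranscendenceDegree
-- Upper bound 1 when `K` contains `𝔽₄`.
section Split

variable {K V G : Type*} [Field K] [AddCommGroup V] [Module K V] [FiniteDimensional K V]
  [Group G] [Finite G] [Nontrivial G] [CharP K 2]

open Cardinal IntermediateField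

theorem map_specialLinearGroup_injective {F F' : Type*} [Field F] [Field F'] (φ : F →+* F') :
    Function.Injective (Matrix.SpecialLinearGroup.map (n := Fin 2) φ) := by
  intro M N h
  ext i j
  have := congrArg (fun X : Matrix.SpecialLinearGroup (Fin 2) F' => X i j) h
  exact φ.injective (by simpa using this)

theorem exists_faithfulSubfield_trdeg_le_one {ρ : Representation K G V}
    (hρ : Function.Injective ρ) (φ : GaloisField 2 2 →+* K)
    (π : G →* Matrix.SpecialLinearGroup (Fin 2) (GaloisField 2 2)) (hπ : Function.Injective π) :
    ∃ E, IsFaithfulSubfield ρ E ∧ Algebra.trdeg K E ≤ (1 : ℕ) := by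
  obtain ⟨x, hx⟩ := exists_linearIndependent_orbit (fieldAut ρ) (fieldAut_injective hρ)
  obtain ⟨t, ht, hf⟩ := exists_moebius_coordinate (algebraMap K (FunField K V))
    (fun x a b c h hne => mem_range_of_isAlgebraic
      ⟨Polynomial.C a * Polynomial.X ^ 2 + Polynomial.C b * Polynomial.X + Polynomial.C c, by
        intro h0
        refine hne ⟨?_, ?_, ?_⟩
        · simpa using congrArg (Polynomial.coeff · 2) h0
        · simpa using congrArg (Polynomial.coeff · 1) h0
        · simpa using congrArg (Polynomial.coeff · 0) h0, by simpa using h⟩)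
    (fun g => (fieldAut ρ g : FunField K V →+* FunField K V)) (fun g r => (fieldAut ρ g).commutes r)
    (fun g => fieldAut ρ g x) (fun g h => by simp)
    (fun c hc => by
      have := Fintype.ofFinite G
      rw [finsum_eq_sum_of_fintype] at hc
      exact Fintype.linearIndependent_iff.1 hx c (by simpa [Algebra.smul_def] using hc))
    ((Matrix.SpecialLinearGroup.map φ).comp π) ((map_specialLinearGroup_injective φ).comp hπ)
  refine ⟨adjoin K {t}, ⟨fun g y hy => ?_, fun g hg => hf g (hg t (mem_adjoin_simple_self K t))⟩, ?_⟩
  · have h1 : (adjoin K {t}).map (fieldAut ρ g : FunField K V →ₐ[K] FunField K V) ≤ adjoin K {t} := by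
      rw [adjoin_map, adjoin_le_iff, Set.image_singleton, Set.singleton_subset_iff]
      obtain ⟨a, b, c, d, h⟩ := ht g
      have hm := mem_adjoin_simple_self K t
      have hk : ∀ r, algebraMap K (FunField K V) r ∈ adjoin K {t} := fun r => IntermediateField.algebraMap_mem _ r
      exact (congrArg (· ∈ adjoin K {t}) h).mpr
        (div_mem (add_mem (mul_mem (hk _) hm) (hk _)) (add_mem (mul_mem (hk _) hm) (hk _)))
    exact h1 ⟨y, hy, rfl⟩
  · refine (trdeg_adjoin_le {t}).trans ?_
    simp

end Split

/-! ### Upper bound 2 by adjoining a cube root of unity and descending. -/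

section Quadratic

variable {K V G : Type*} [Field K] [AddCommGroup V] [Module K V] [FiniteDimensional K V]
  [Group G] [Finite G] [Nontrivial G] [CharP K 2]

open Cardinal IntermediateField QuadraticAlgebra

/-- Functoriality in `R` of the algebra obtained by adjoining a cube root of unity to a ring `R` of
characteristic two. -/
def quadMap {K R S : Type*} [CommRing K] [CommRing R] [CommRing S] [Algebra K R] [Algebra K S]
    (f : R →ₐ[K] S) : QuadraticAlgebra R 1 1 →ₐ[K] QuadraticAlgebra S 1 1 where
  toFun z := ⟨f z.re, f z.im⟩
  map_one' := by ext <;> simp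
  map_mul' z w := by ext <;> simp
  map_zero' := by ext <;> simp
  map_add' z w := by ext <;> simp
  commutes' r := QuadraticAlgebra.ext (f.commutes r) (map_zero f)

/-- Conjugation. -/
def quadConj (K R : Type*) [CommRing K] [CommRing R] [Algebra K R] :
    QuadraticAlgebra R 1 1 →ₐ[K] QuadraticAlgebra R 1 1 where
  toFun := star
  map_one' := star_one _
  map_mul' z w := by rw [star_mul, mul_comm]
  map_zero' := star_zero _
  map_add' := star_add
  commutes' r := QuadraticAlgebra.ext
    (show algebraMap K R r + 1 * 0 = _ by rw [mul_zero, add_zero]; rfl) (neg_zero (G := R))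

instance charP_quadraticAlgebra {R : Type*} [CommRing R] [CharP R 2] :
    CharP (QuadraticAlgebra R 1 1) 2 :=
  charP_of_injective_algebraMap (R := R) QuadraticAlgebra.algebraMap_injective 2

theorem coordinates_eq {R : Type*} [CommRing R] [CharP R 2] (z : QuadraticAlgebra R 1 1) :
    algebraMap R _ z.im = z + star z ∧ algebraMap R _ z.re = z - ω * (z + star z) := by
  have h2 := CharTwo.two_eq_zero (R := R)
  constructor <;> ext <;> simp
  · linear_combination -z.re * h2
  · linear_combination z.re * h2

variable {L : Type*} [Field L] [Algebra K L]

/-- The coordinates of `z` are polynomials in `z`, its conjugate and `ω`, all algebraic over `K`, so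
they lie in `K`. -/
theorem mem_range_quadMap (hL : ∀ x : L, IsAlgebraic K x → x ∈ (algebraMap K L).range)
    [Fact (∀ r : L, r ^ 2 ≠ 1 + 1 * r)] {z : QuadraticAlgebra L 1 1} (hz : IsAlgebraic K z) :
    ∃ w, quadMap (Algebra.ofId K L) w = z := by
  have := charP_of_injective_algebraMap (algebraMap K L).injective 2
  have hz' : IsAlgebraic K (star z) := hz.algHom (quadConj K L)
  have hω : IsAlgebraic K (ω : QuadraticAlgebra L 1 1) := by
    refine ⟨Polynomial.X ^ 2 - Polynomial.X - 1, fun h => ?_, ?_⟩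
    · simpa [Polynomial.coeff_X, Polynomial.coeff_one] using congrArg (Polynomial.coeff · 2) h
    · ext <;> simp [pow_two]
  obtain ⟨him, hre⟩ := coordinates_eq z
  have hinj : Function.Injective (algebraMap L (QuadraticAlgebra L 1 1)) :=
    QuadraticAlgebra.algebraMap_injective
  obtain ⟨v, hv⟩ := hL z.im ((isAlgebraic_algebraMap_iff hinj).1 (him ▸ hz.add hz'))
  obtain ⟨u, hu⟩ := hL z.re ((isAlgebraic_algebraMap_iff hinj).1
    (hre ▸ hz.sub (hω.mul (hz.add hz'))))
  exact ⟨⟨u, v⟩, QuadraticAlgebra.ext hu hv⟩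

theorem exists_root_of_quadratic_quadMap (hL : ∀ x : L, IsAlgebraic K x → x ∈ (algebraMap K L).range)
    [Fact (∀ r : K, r ^ 2 ≠ 1 + 1 * r)] [Fact (∀ r : L, r ^ 2 ≠ 1 + 1 * r)]
    (x : QuadraticAlgebra L 1 1) (a b c : QuadraticAlgebra K 1 1)
    (h : quadMap (Algebra.ofId K L) a * x ^ 2 + quadMap (Algebra.ofId K L) b * x +
      quadMap (Algebra.ofId K L) c = 0) (hne : ¬ (a = 0 ∧ b = 0 ∧ c = 0)) :
    ∃ w, quadMap (Algebra.ofId K L) w = x := by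
  apply mem_range_quadMap hL
  let _ : Algebra (QuadraticAlgebra K 1 1) (QuadraticAlgebra L 1 1) :=
    (quadMap (Algebra.ofId K L)).toRingHom.toAlgebra
  have : IsScalarTower K (QuadraticAlgebra K 1 1) (QuadraticAlgebra L 1 1) :=
    IsScalarTower.of_algebraMap_eq fun r => ((quadMap (Algebra.ofId K L)).commutes r).symm
  have hx : IsAlgebraic (QuadraticAlgebra K 1 1) x := by
    refine ⟨Polynomial.C a * Polynomial.X ^ 2 + Polynomial.C b * Polynomial.X + Polynomial.C c,
      fun h0 => hne ⟨?_, ?_, ?_⟩, ?_⟩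
    · simpa using congrArg (Polynomial.coeff · 2) h0
    · simpa using congrArg (Polynomial.coeff · 1) h0
    · simpa using congrArg (Polynomial.coeff · 0) h0
    · simp only [map_add, map_mul, map_pow, Polynomial.aeval_C, Polynomial.aeval_X]
      exact h
  exact hx.restrictScalars K

theorem exists_stable_faithful_trdeg_le_two
    (hL : ∀ x : L, IsAlgebraic K x → x ∈ (algebraMap K L).range)
    (σ : G →* (L ≃ₐ[K] L)) (hσ : Function.Injective σ) (hK : ∀ r : K, r ^ 2 + r + 1 ≠ 0)
    (π : G →* Matrix.SpecialLinearGroup (Fin 2) (GaloisField 2 2)) (hπ : Function.Injective π) :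
    ∃ E : IntermediateField K L, (∀ g, ∀ x ∈ E, σ g x ∈ E) ∧
      (∀ g, (∀ x ∈ E, σ g x = x) → g = 1) ∧ Algebra.trdeg K E ≤ (2 : ℕ) := by
  have hcL : CharP L 2 := charP_of_injective_algebraMap (algebraMap K L).injective 2
  have hKf : Fact (∀ r : K, r ^ 2 ≠ 1 + 1 * r) := ⟨fun r h => hK r (by
    linear_combination h + (r + 1) * CharTwo.two_eq_zero (R := K))⟩
  -- A root in `L` would be algebraic over `K`, hence in `K`; so `L(ω)` is again a field.
  have hLf : Fact (∀ r : L, r ^ 2 ≠ 1 + 1 * r) := ⟨fun r h => by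
    obtain ⟨r, rfl⟩ := hL r ⟨Polynomial.X ^ 2 - Polynomial.X - 1, fun h => by
      simpa [Polynomial.coeff_X, Polynomial.coeff_one] using congrArg (Polynomial.coeff · 2) h, by
      simp [h]⟩
    exact hKf.out r ((algebraMap K L).injective (by simpa using h))⟩
  obtain ⟨φ⟩ := nonempty_galoisField_hom (K := QuadraticAlgebra K 1 1) (r := ω) (by
    have h2 := CharTwo.two_eq_zero (R := K)
    ext <;> simp [pow_two]
    · linear_combination h2
    · linear_combination h2)
  obtain ⟨x, hx⟩ := exists_linearIndependent_orbit σ hσ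
  let s : G → (QuadraticAlgebra L 1 1 →ₐ[K] QuadraticAlgebra L 1 1) :=
    fun g => quadMap (σ g : L →ₐ[K] L)
  obtain ⟨t, ht, hf⟩ := exists_moebius_coordinate
    (quadMap (Algebra.ofId K L)).toRingHom (exists_root_of_quadratic_quadMap hL)
    (fun g => (s g).toRingHom)
    (fun g r => QuadraticAlgebra.ext ((σ g).commutes r.re) ((σ g).commutes r.im))
    (fun g => algebraMap L (QuadraticAlgebra L 1 1) (σ g x))
    (fun g h => QuadraticAlgebra.ext (by simp [s, quadMap]) (by simp [s, quadMap]))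
    (fun c hc => by
      have := Fintype.ofFinite G
      rw [finsum_eq_sum_of_fintype] at hc
      have h1 := congrArg (reₗ (1 : L) 1) hc
      have h2 := congrArg (imₗ (1 : L) 1) hc
      rw [map_sum] at h1 h2
      intro g
      refine QuadraticAlgebra.ext (Fintype.linearIndependent_iff.1 hx (fun g => (c g).re) ?_ g)
        (Fintype.linearIndependent_iff.1 hx (fun g => (c g).im) ?_ g)
      · simpa [quadMap, Algebra.smul_def, Algebra.ofId_apply] using h1
      · simpa [quadMap, Algebra.smul_def, Algebra.ofId_apply] using h2)
    ((Matrix.SpecialLinearGroup.map φ).comp π) ((map_specialLinearGroup_injective φ).comp hπ)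
  -- Conjugation commutes with `G`, so `star t` is moved by the conjugate fractional linear maps and
  -- `K(T)` is `G`-stable. It contains both coordinates of `t`, so its trace on `L` is still
  -- faithful.
  let T : Set (QuadraticAlgebra L 1 1) := {ω, t, star t}
  have hTω : ω ∈ adjoin K T := subset_adjoin K T (by simp [T])
  have hTt : t ∈ adjoin K T := subset_adjoin K T (by simp [T])
  have hTt' : star t ∈ adjoin K T := subset_adjoin K T (by simp [T])
  have hTk : ∀ r, quadMap (Algebra.ofId K L) r ∈ adjoin K T := by
    intro r
    have : quadMap (Algebra.ofId K L) r = algebraMap K _ r.re + algebraMap K _ r.im * ω := by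
      rw [IsScalarTower.algebraMap_apply K L (QuadraticAlgebra L 1 1),
        IsScalarTower.algebraMap_apply K L (QuadraticAlgebra L 1 1)]
      ext <;> simp [quadMap, Algebra.ofId_apply]
    rw [this]
    exact add_mem (IntermediateField.algebraMap_mem _ _)
      (mul_mem (IntermediateField.algebraMap_mem _ _) hTω)
  have hst : ∀ g, s g (star t) = star (s g t) := fun g => by
    ext <;> simp [s, quadMap]
  have hsT : ∀ g, (adjoin K T).map (s g) ≤ adjoin K T := by
    intro g
    obtain ⟨a, b, c, d, h⟩ := ht g
    replace h : s g t = (quadMap (Algebra.ofId K L) a * t + quadMap (Algebra.ofId K L) b) /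
        (quadMap (Algebra.ofId K L) c * t + quadMap (Algebra.ofId K L) d) := h
    rw [adjoin_map, adjoin_le_iff]
    rintro _ ⟨z, hz | hz | hz, rfl⟩
    · have : s g ω = ω := by ext <;> simp [s, quadMap]
      rw [hz, this]
      exact hTω
    · rw [hz, h]
      exact div_mem (add_mem (mul_mem (hTk _) hTt) (hTk _)) (add_mem (mul_mem (hTk _) hTt) (hTk _))
    · have hc : ∀ r : QuadraticAlgebra K 1 1, quadConj K L (quadMap (Algebra.ofId K L) r) =
          quadMap (Algebra.ofId K L) (star r) := by
        intro r
        ext <;> simp [quadMap, quadConj]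
      have h' : s g (star t) = quadConj K L (s g t) := hst g
      have h'' : quadConj K L t = star t := rfl
      rw [Set.mem_singleton_iff.1 hz, h', h]
      rw [map_div₀, map_add, map_add, map_mul, map_mul, hc, hc, hc, hc, h'']
      exact div_mem (add_mem (mul_mem (hTk _) hTt') (hTk _))
        (add_mem (mul_mem (hTk _) hTt') (hTk _))
  let ι : L →ₐ[K] QuadraticAlgebra L 1 1 := IsScalarTower.toAlgHom K L _
  refine ⟨(adjoin K T).comap ι, fun g y hy => ?_, fun g hg => hf g ?_, ?_⟩
  · have h1 : ι (σ g y) = s g (ι y) := by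
      ext <;> simp [s, ι, quadMap]
    show ι (σ g y) ∈ adjoin K T
    rw [h1]
    exact hsT g ⟨ι y, hy, rfl⟩
  · obtain ⟨him, hre⟩ := coordinates_eq t
    have h1 : t.im ∈ (adjoin K T).comap ι := by
      show algebraMap L _ t.im ∈ adjoin K T
      rw [him]
      exact add_mem hTt hTt'
    have h2 : t.re ∈ (adjoin K T).comap ι := by
      show algebraMap L _ t.re ∈ adjoin K T
      rw [hre]
      exact sub_mem hTt (mul_mem hTω (add_mem hTt hTt'))
    exact QuadraticAlgebra.ext (hg _ h2) (hg _ h1)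
  · have h1 : Algebra.trdeg K ((adjoin K T).comap ι) ≤ Algebra.trdeg K (adjoin K T) :=
      trdeg_le_of_injective ((ι.comp ((adjoin K T).comap ι).val).codRestrict
        (adjoin K T).toSubalgebra fun y => y.2) (fun y z h => Subtype.ext
          (ι.injective (congrArg Subtype.val h)))
    -- `ω` is algebraic over `K`, so only `t` and its conjugate count.
    refine h1.trans ((trdeg_adjoin_le_of_isAlgebraic {t, star t} T ?_).trans ?_)
    · rintro z (rfl | hz)
      · refine IsAlgebraic.tower_top (K := K) _ ⟨Polynomial.X ^ 2 - Polynomial.X - 1, fun h => ?_, ?_⟩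
        · simpa [Polynomial.coeff_X, Polynomial.coeff_one] using congrArg (Polynomial.coeff · 2) h
        · ext <;> simp [pow_two]
      · exact isAlgebraic_algebraMap (⟨z, subset_adjoin K _ hz⟩ : adjoin K {t, star t})
    · exact Cardinal.mk_insert_le.trans (by simp; norm_num)

theorem exists_faithfulSubfield_trdeg_le_two {ρ : Representation K G V}
    (hρ : Function.Injective ρ) (hK : ∀ r : K, r ^ 2 + r + 1 ≠ 0)
    (π : G →* Matrix.SpecialLinearGroup (Fin 2) (GaloisField 2 2)) (hπ : Function.Injective π) :
    ∃ E, IsFaithfulSubfield ρ E ∧ Algebra.trdeg K E ≤ (2 : ℕ) := by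
  obtain ⟨E, h1, h2, h3⟩ := exists_stable_faithful_trdeg_le_two (K := K) (L := FunField K V)
    (fun x => mem_range_of_isAlgebraic) (fieldAut ρ) (fieldAut_injective hρ) hK π hπ
  exact ⟨E, ⟨h1, h2⟩, h3⟩

end Quadratic
-- Embedding subfields of transcendence degree one into `K(X)`.
section Kronecker

variable {K : Type*} [Field K] {n : ℕ}

open Polynomial

/-- Kronecker substitution `Xᵢ ↦ X ^ N ^ i`. -/
noncomputable def kronecker (K : Type*) [Field K] (n N : ℕ) : MvPolynomial (Fin n) K →ₐ[K] K[X] :=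
  MvPolynomial.aeval fun i => X ^ N ^ (i : ℕ)

/-- All exponents are below `N`, so they are base-`N` digits and distinct monomials go to distinct
powers of `X`. -/
theorem kronecker_ne_zero {N : ℕ} {p : MvPolynomial (Fin n) K} (hp : p ≠ 0)
    (hN : p.totalDegree < N) : kronecker K n N p ≠ 0 := by
  obtain ⟨s, hs⟩ := MvPolynomial.ne_zero_iff.1 hp
  have hlt : ∀ r ∈ p.support, ∀ i, r i < N := by
    intro r hr i
    have h1 := MvPolynomial.le_totalDegree hr
    have h2 : r i ≤ r.sum fun _ e => e := by
      by_cases h : r i = 0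
      · omega
      · exact Finset.single_le_sum (f := fun j => r j) (fun _ _ => Nat.zero_le _)
          (Finsupp.mem_support_iff.2 h)
    omega
  have hs' : s ∈ p.support := MvPolynomial.mem_support_iff.2 hs
  have hinj : ∀ r ∈ p.support, ∑ i, r i * N ^ (i : ℕ) = ∑ i, s i * N ^ (i : ℕ) → r = s := by
    intro r hr h
    have h1 : finFunctionFinEquiv (fun i => (⟨r i, hlt r hr i⟩ : Fin N)) =
        finFunctionFinEquiv (fun i => (⟨s i, hlt s hs' i⟩ : Fin N)) := by
      ext
      simpa [finFunctionFinEquiv_apply] using h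
    ext i
    exact congrArg Fin.val (congrFun (finFunctionFinEquiv.injective h1) i)
  intro h
  have h1 : (kronecker K n N p).coeff (∑ i, s i * N ^ (i : ℕ)) = p.coeff s := by
    have h2 : kronecker K n N p = ∑ r ∈ p.support, C (p.coeff r) * X ^ ∑ i, r i * N ^ (i : ℕ) := by
      rw [kronecker, MvPolynomial.aeval_def, MvPolynomial.eval₂_eq']
      refine Finset.sum_congr rfl fun r _ => ?_
      rw [Polynomial.algebraMap_eq, ← Finset.prod_pow_eq_pow_sum]
      congr 1
      exact Finset.prod_congr rfl fun i _ => by rw [← pow_mul, mul_comm]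
    rw [h2, finsetSum_coeff, Finset.sum_eq_single s]
    · simp
    · intro r hr hrs
      rw [coeff_C_mul, coeff_X_pow, if_neg fun h' => hrs (hinj r hr h'.symm), mul_zero]
    · exact fun h' => absurd hs' h'
  rw [h, coeff_zero] at h1
  exact hs h1.symm

/-- `A` is algebraic over `K[e]`. A nonzero element of the kernel satisfies a relation whose
constant term is a nonzero polynomial in `e`; applying `ψ` gives a relation for `ψ e`. -/
theorem algHom_injective_of_transcendental {A F : Type*} [CommRing A] [IsDomain A] [Algebra K A]
    [Field F] [Algebra K F] (hA : Algebra.trdeg K A ≤ 1) (ψ : A →ₐ[K] F) {e : A}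
    (he : Transcendental K (ψ e)) : Function.Injective ψ := by
  have he' : Transcendental K e := fun h => he (h.algHom ψ)
  have hi : AlgebraicIndependent K (fun _ : Unit => e) :=
    algebraicIndependent_unique_type_iff.2 he'
  have hb := AlgebraicIndependent.isTranscendenceBasis_of_lift_trdeg_le_of_finite hi
    (by simpa using hA)
  have halg := hb.isAlgebraic
  rw [injective_iff_map_eq_zero]
  intro a ha
  by_contra hne
  obtain ⟨q, hq0, hq⟩ := (halg.isAlgebraic a).exists_nonzero_coeff_and_aeval_eq_zero
    (mem_nonZeroDivisors_of_ne_zero hne)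
  have h1 : ψ (q.coeff 0 : A) = 0 := by
    have h2 := congrArg ψ hq
    rw [← divX_mul_X_add q] at h2
    simp only [map_add, map_mul, aeval_X, aeval_C, ha, mul_zero, zero_add, map_zero] at h2
    exact h2
  have hmem : ∀ x ∈ Algebra.adjoin K (Set.range fun _ : Unit => e),
      ∃ r : K[X], aeval e r = x := by
    intro x hx
    rw [Set.range_const, Algebra.adjoin_singleton_eq_range_aeval] at hx
    exact hx
  obtain ⟨r, hr⟩ := hmem _ (q.coeff 0).2
  rw [← hr, ← aeval_algHom_apply] at h1
  have hr0 := transcendental_iff.1 he r h1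
  rw [hr0, map_zero] at hr
  exact hq0 (Subtype.ext hr.symm)

-- Kronecker substitution needs no points of `K`, so the argument also covers finite `K`. It extends
-- to fractions whose denominators it does not kill; keeping `e` nonconstant makes it injective on
-- `K[T]`, hence extendable to `K(T)`.
open IntermediateField algebraAdjoinAdjoin in
theorem nonempty_algHom_ratFunc {T : Set (FractionRing (MvPolynomial (Fin n) K))} (hT : T.Finite)
    {e : FractionRing (MvPolynomial (Fin n) K)} (heT : e ∈ T) (he : Transcendental K e)
    (hd : Algebra.trdeg K (adjoin K T) ≤ 1) : Nonempty (adjoin K T →ₐ[K] RatFunc K) := by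
  let R := MvPolynomial (Fin n) K
  let L := FractionRing R
  obtain ⟨⟨d, hd0⟩, hdT⟩ := IsLocalization.exist_integer_multiples_of_finset (nonZeroDivisors R)
    hT.toFinset
  have hd0' : d ≠ 0 := nonZeroDivisors.ne_zero hd0
  have hdL : algebraMap R L d ≠ 0 := by
    simpa using hd0'
  have hfrac : ∀ x ∈ T, ∃ p : R, x = algebraMap R L p * (algebraMap R L d)⁻¹ := by
    intro x hx
    obtain ⟨p, hp⟩ := hdT x (hT.mem_toFinset.2 hx)
    refine ⟨p, ?_⟩
    rw [hp]
    exact (eq_mul_inv_iff_mul_eq₀ hdL).2 ((mul_comm _ _).trans (Algebra.smul_def d x).symm)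
  obtain ⟨p, hp⟩ := hfrac e heT
  -- Large enough that neither `d` nor any nonzero `p - c • d` is killed.
  let N := max d.totalDegree p.totalDegree + 1
  let κ := kronecker K n N
  have hκd : κ d ≠ 0 := kronecker_ne_zero hd0' (by omega)
  let S : Submonoid R := (nonZeroDivisors K[X]).comap κ
  have hS : S ≤ nonZeroDivisors R := by
    intro s hs
    refine mem_nonZeroDivisors_of_ne_zero ?_
    rintro rfl
    exact nonZeroDivisors.ne_zero (M₀ := K[X]) hs (map_zero κ)
  have hdS : d ∈ S := mem_nonZeroDivisors_of_ne_zero hκd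
  let B := Localization.subalgebra.ofField L S hS
  have hBloc : IsLocalization S B := Localization.subalgebra.isLocalization_ofField L S hS
  let κ' : R →ₐ[K] RatFunc K := (IsScalarTower.toAlgHom K K[X] (RatFunc K)).comp κ
  have hκ' : ∀ s : S, IsUnit (κ' s) := by
    intro s
    refine isUnit_iff_ne_zero.2 ?_
    have := nonZeroDivisors.ne_zero (M₀ := K[X]) s.2
    simpa [κ'] using this
  let g : B →ₐ[K] RatFunc K := IsLocalization.liftAlgHom (M := S) (f := κ') hκ'
  have hAB : Algebra.adjoin K T ≤ B.restrictScalars K := by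
    rw [Algebra.adjoin_le_iff]
    intro x hx
    obtain ⟨q, hq⟩ := hfrac x hx
    exact ⟨q, d, hdS, hq⟩
  let i : Algebra.adjoin K T →ₐ[K] B := (Algebra.adjoin K T).val.codRestrict (B.restrictScalars K)
    fun x => hAB x.2
  let ψ : Algebra.adjoin K T →ₐ[K] RatFunc K := g.comp i
  let e' : Algebra.adjoin K T := ⟨e, Algebra.subset_adjoin heT⟩
  have hψe : ψ e' * κ' d = κ' p := by
    have h1 : i e' * algebraMap R B d = algebraMap R B p := by
      apply Subtype.ext
      show e * algebraMap R L d = algebraMap R L p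
      rw [hp, inv_mul_cancel_right₀ hdL]
    have h2 := congrArg g h1
    rw [map_mul] at h2
    have h3 : ∀ r, g (algebraMap R B r) = κ' r := fun r => IsLocalization.lift_eq _ r
    rw [h3, h3] at h2
    exact h2
  have htr : Transcendental K (ψ e') := by
    apply RatFunc.transcendental_of_ne_C
    rintro ⟨c, hc⟩
    have h1 : κ (p - c • d) = 0 := by
      apply IsFractionRing.injective K[X] (RatFunc K)
      rw [hc] at hψe
      have h2 : algebraMap K[X] (RatFunc K) (κ p) = RatFunc.C c * algebraMap K[X] (RatFunc K) (κ d) :=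
        hψe.symm
      rw [map_sub, map_sub, h2, map_smul, smul_eq_C_mul, map_mul, RatFunc.algebraMap_C, map_zero,
        sub_self]
    have h2 : p = c • d := by
      by_contra hne
      refine kronecker_ne_zero (sub_ne_zero.2 hne) ?_ h1
      have h3 := MvPolynomial.totalDegree_sub p (c • d)
      have h4 := MvPolynomial.totalDegree_smul_le c d
      omega
    have h3 : e = algebraMap K L c := by
      rw [hp, h2, MvPolynomial.smul_eq_C_mul, map_mul, mul_assoc, mul_inv_cancel₀ hdL, mul_one]
      rfl
    exact he (h3 ▸ isAlgebraic_algebraMap c)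
  have hA : Algebra.trdeg K (Algebra.adjoin K T) ≤ 1 :=
    (trdeg_le_of_injective (IsScalarTower.toAlgHom K (Algebra.adjoin K T) (adjoin K T))
      (IsFractionRing.injective _ _)).trans hd
  exact ⟨IsFractionRing.liftAlgHom (algHom_injective_of_transcendental hA ψ htr)⟩

end Kronecker
-- Automorphisms of `K(X)` as matrices up to scalars.
section Moebius

variable {K : Type*} [Field K]

open Matrix

/-- The endomorphism `θ` of `K(X)` is the fractional linear substitution with matrix `M`. -/
structure IsMoebius (θ : RatFunc K →ₐ[K] RatFunc K) (M : Matrix (Fin 2) (Fin 2) K) : Prop where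
  det_ne_zero : M 0 0 * M 1 1 - M 0 1 * M 1 0 ≠ 0
  apply_X : RatFunc.C (M 0 0) * RatFunc.X + RatFunc.C (M 0 1) =
    θ RatFunc.X * (RatFunc.C (M 1 0) * RatFunc.X + RatFunc.C (M 1 1))

theorem ratFunc_algHom_ext {A : Type*} [Field A] [Algebra K A] {f g : RatFunc K →ₐ[K] A}
    (h : f RatFunc.X = g RatFunc.X) : f = g := by
  ext x
  rw [← RatFunc.num_div_denom x, map_div₀, map_div₀]
  have h1 : ∀ p : Polynomial K, f (algebraMap _ _ p) = g (algebraMap _ _ p) := by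
    intro p
    have : f.comp (IsScalarTower.toAlgHom K (Polynomial K) (RatFunc K)) =
        g.comp (IsScalarTower.toAlgHom K (Polynomial K) (RatFunc K)) := by
      ext
      simpa using h
    exact DFunLike.congr_fun this p
  rw [h1, h1]

theorem linear_eq_zero {a b : K} (h : RatFunc.C a * RatFunc.X + RatFunc.C b = 0) :
    a = 0 ∧ b = 0 := by
  have h1 : (Polynomial.C a * Polynomial.X + Polynomial.C b : Polynomial K) = 0 := by
    apply IsFractionRing.injective (Polynomial K) (RatFunc K)
    simpa using h
  exact ⟨by simpa using congrArg (Polynomial.coeff · 1) h1,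
    by simpa using congrArg (Polynomial.coeff · 0) h1⟩

theorem quadratic_eq_zero {a b c : K}
    (h : RatFunc.C a * RatFunc.X ^ 2 + RatFunc.C b * RatFunc.X + RatFunc.C c = 0) :
    a = 0 ∧ b = 0 ∧ c = 0 := by
  have h1 : (Polynomial.C a * Polynomial.X ^ 2 + Polynomial.C b * Polynomial.X +
      Polynomial.C c : Polynomial K) = 0 := by
    apply IsFractionRing.injective (Polynomial K) (RatFunc K)
    simpa using h
  exact ⟨by simpa using congrArg (Polynomial.coeff · 2) h1,
    by simpa using congrArg (Polynomial.coeff · 1) h1,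
    by simpa using congrArg (Polynomial.coeff · 0) h1⟩

theorem IsMoebius.comp {θ θ' : RatFunc K →ₐ[K] RatFunc K} {M M' : Matrix (Fin 2) (Fin 2) K}
    (h : IsMoebius θ M) (h' : IsMoebius θ' M') : IsMoebius (θ'.comp θ) (M * M') := by
  constructor
  · simp only [mul_apply, Fin.sum_univ_two]
    have := mul_ne_zero h.det_ne_zero h'.det_ne_zero
    intro h0
    exact this (by linear_combination h0)
  · have h1 := congrArg θ' h.apply_X
    have hc : ∀ c, θ' (RatFunc.C c) = RatFunc.C c := fun c => θ'.commutes c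
    simp only [map_add, map_mul, hc] at h1
    have h2 := h'.apply_X
    simp only [mul_apply, Fin.sum_univ_two, map_add, map_mul, AlgHom.comp_apply]
    linear_combination (RatFunc.C (M' 1 0) * RatFunc.X + RatFunc.C (M' 1 1)) * h1 +
      (RatFunc.C (M 0 0) - θ' (θ RatFunc.X) * RatFunc.C (M 1 0)) * h2

/-- Cross-multiplying the two expressions for `θ X` gives a quadratic polynomial identity; with `det
M ≠ 0` its coefficients force the matrices to be proportional. -/
theorem IsMoebius.unique {θ : RatFunc K →ₐ[K] RatFunc K} {M M' : Matrix (Fin 2) (Fin 2) K}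
    (h : IsMoebius θ M) (h' : IsMoebius θ M') : ∃ u : K, u ≠ 0 ∧ M' = u • M := by
  have hd := h.det_ne_zero
  have h1 := h.apply_X
  have h2 := h'.apply_X
  obtain ⟨e1, e2, e3⟩ := quadratic_eq_zero
    (a := M 0 0 * M' 1 0 - M' 0 0 * M 1 0)
    (b := M 0 0 * M' 1 1 + M 0 1 * M' 1 0 - M' 0 0 * M 1 1 - M' 0 1 * M 1 0)
    (c := M 0 1 * M' 1 1 - M' 0 1 * M 1 1) (by
      simp only [map_sub, map_add, map_mul]
      linear_combination (RatFunc.C (M' 1 0) * RatFunc.X + RatFunc.C (M' 1 1)) * h1 -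
        (RatFunc.C (M 1 0) * RatFunc.X + RatFunc.C (M 1 1)) * h2)
  generalize hD : M 0 0 * M 1 1 - M 0 1 * M 1 0 = D at hd
  have e4 : M 0 0 * M' 0 1 - M' 0 0 * M 0 1 = 0 := by
    refine (mul_eq_zero.1 (?_ : D * _ = 0)).resolve_left hd
    rw [← hD]
    linear_combination - M 0 0 ^ 2 * e3 + M 0 0 * M 0 1 * e2 - M 0 1 ^ 2 * e1
  have e5 : M 0 1 * M' 1 0 - M' 0 1 * M 1 0 = 0 := by
    refine (mul_eq_zero.1 (?_ : D * _ = 0)).resolve_left hd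
    rw [← hD]
    linear_combination M 0 1 * M 1 1 * e1 - M 0 1 * M 1 0 * e2 + M 0 0 * M 1 0 * e3
  have hM : M' = ((M' 0 0 * M 1 1 - M' 0 1 * M 1 0) / D) • M := by
    ext i j
    fin_cases i <;> fin_cases j <;> simp <;> field_simp <;> rw [← hD]
    · linear_combination M 1 0 * e4
    · linear_combination M 1 1 * e4
    · linear_combination M 1 1 * e1 - M 1 0 * e5
    · linear_combination M 1 1 * (e2 - e5) - M 1 0 * e3
  refine ⟨_, fun h0 => h'.det_ne_zero ?_, hM⟩
  rw [h0, zero_smul] at hM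
  simp [hM]

theorem IsMoebius.one : IsMoebius (AlgHom.id K (RatFunc K)) 1 := ⟨by simp, by simp⟩

theorem IsMoebius.eq_id {θ : RatFunc K →ₐ[K] RatFunc K} {c : K} (h : IsMoebius θ (c • 1)) :
    θ = AlgHom.id K _ := by
  apply ratFunc_algHom_ext
  have h1 := h.det_ne_zero
  have h2 := h.apply_X
  simp at h1 h2 ⊢
  have h3 : RatFunc.C c ≠ 0 := by simpa using h1
  apply mul_right_cancel₀ h3
  rw [← h2, mul_comm]

-- Surjectivity gives `K(θ X) = K(X)`, and the degree of `K(X)` over `K(f)` is the larger of the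
-- degrees of numerator and denominator of `f`, so both are at most 1. The determinant is nonzero
-- because `θ X` is not constant.
open IntermediateField in
theorem exists_isMoebius {θ : RatFunc K →ₐ[K] RatFunc K} (hθ : Function.Surjective θ) :
    ∃ M, IsMoebius θ M := by
  let f := θ RatFunc.X
  have htop : K⟮f⟯ = ⊤ := by
    rw [← AlgHom.fieldRange_eq_top.2 hθ, AlgHom.fieldRange_eq_map, ← RatFunc.adjoin_X, adjoin_map,
      Set.image_singleton]
  have hr := RatFunc.finrank_eq_max_natDegree f
  rw [htop, IntermediateField.finrank_top] at hr
  have hn : f.num.natDegree ≤ 1 := hr ▸ le_max_left _ _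
  have hdn : f.denom.natDegree ≤ 1 := hr ▸ le_max_right _ _
  have hn' := Polynomial.eq_X_add_C_of_natDegree_le_one hn
  have hdn' := Polynomial.eq_X_add_C_of_natDegree_le_one hdn
  have h0 := f.denom_ne_zero
  have hf := f.num_div_denom
  rw [div_eq_iff (by simpa using h0)] at hf
  generalize f.num.coeff 1 = a, f.num.coeff 0 = b at hn'
  generalize f.denom.coeff 1 = c, f.denom.coeff 0 = d at hdn'
  rw [hn', hdn'] at hf
  rw [hdn'] at h0
  simp at hf
  have hne : ∀ k, f ≠ RatFunc.C k := by
    intro k hk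
    have h1 : θ RatFunc.X = θ (RatFunc.C k) := hk.trans (θ.commutes k).symm
    have h2 := θ.injective h1
    have h3 := linear_eq_zero (a := 1) (b := -k) (by rw [h2]; simp)
    exact one_ne_zero h3.1
  refine ⟨!![a, b; c, d], ?_, ?_⟩
  · simp
    intro h1
    have hden : (RatFunc.C c * RatFunc.X + RatFunc.C d : RatFunc K) ≠ 0 := by
      intro h
      obtain ⟨rfl, rfl⟩ := linear_eq_zero h
      simp at h0
    by_cases hc : c = 0
    · subst hc
      have hd : d ≠ 0 := by
        rintro rfl
        simp at h0
      obtain rfl : a = 0 := by simpa [hd] using h1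
      refine hne (b / d) (mul_right_cancel₀ hden ?_)
      rw [← hf]
      have : RatFunc.C d ≠ 0 := by simpa using hd
      simp
      field_simp
    · refine hne (a / c) (mul_right_cancel₀ hden ?_)
      rw [← hf]
      have hc' : RatFunc.C c ≠ 0 := by simpa using hc
      have h2 := congrArg RatFunc.C h1
      simp at h2
      rw [map_div₀]
      field_simp
      linear_combination -h2
  · simpa using hf

theorem exists_cube_root_of_hom [CharP K 2] {G : Type*} [Group G]
    (Θ : G →* (RatFunc K →ₐ[K] RatFunc K)) (hΘ : Function.Injective Θ) {a b s : G}
    (ha : a * a = 1) (hb : b * b = 1) (hba : (b * a) * (b * a) = 1) (ha1 : a ≠ 1) (hb1 : b ≠ 1)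
    (hba1 : b * a ≠ 1) (hs : b * s = s * a) (hs' : b * a * s = s * b) :
    ∃ r : K, r ^ 2 + r + 1 = 0 := by
  have hsurj : ∀ g, Function.Surjective (Θ g) := fun g x => ⟨Θ g⁻¹ x, by
    rw [← AlgHom.mul_apply, ← map_mul, mul_inv_cancel, map_one, AlgHom.one_apply]⟩
  choose M hM using fun g => exists_isMoebius (hsurj g)
  -- Substitution reverses products, which is why the group relations are stated in the opposite
  -- order to the matrix relations.
  have hmul : ∀ g h, IsMoebius (Θ (g * h)) (M h * M g) := fun g h => by
    rw [map_mul]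
    exact (hM h).comp (hM g)
  have hone : IsMoebius (Θ 1) 1 := by
    rw [map_one]
    exact IsMoebius.one
  have hsq : ∀ g, ∀ N, IsMoebius (Θ g) N → g * g = 1 → ∃ α : K, N * N = α • 1 := by
    intro g N hN hg
    have h1 := hN.comp hN
    have h2 : (Θ g).comp (Θ g) = Θ 1 := by
      rw [← hg, map_mul]
      rfl
    rw [h2] at h1
    obtain ⟨u, -, hu⟩ := hone.unique h1
    exact ⟨u, hu⟩
  have hns : ∀ g, ∀ N, IsMoebius (Θ g) N → g ≠ 1 → ∀ c : K, N ≠ c • 1 := by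
    rintro g _ hN hg c rfl
    exact hg (hΘ (hN.eq_id.trans (map_one Θ).symm))
  obtain ⟨α, hα⟩ := hsq a _ (hM a) ha
  obtain ⟨β, hβ⟩ := hsq b _ (hM b) hb
  obtain ⟨γ, hγ⟩ := hsq _ _ (hmul b a) hba
  have h1 := hmul b s
  rw [hs] at h1
  obtain ⟨u, hu, hu'⟩ := (hmul s a).unique h1
  have h2 : IsMoebius (Θ (b * a * s)) (M s * (M a * M b)) := by
    rw [map_mul]
    exact (hM s).comp (hmul b a)
  rw [hs'] at h2
  obtain ⟨w, -, hw'⟩ := (hmul s b).unique h2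
  refine exists_cube_root_of_matrices hα hβ hγ (hns a _ (hM a) ha1) (hns b _ (hM b) hb1)
    (hns _ _ (hmul b a) hba1) ?_ hu hu' hw'
  rw [Matrix.det_fin_two]
  exact (hM s).det_ne_zero

end Moebius

/-! ### Lower bound 2 when `K` does not contain `𝔽₄`. -/

section LowerBound

variable {K : Type*} [Field K] {n : ℕ} {G : Type*} [Group G] [Finite G] [Nontrivial G]

open IntermediateField

/-- A faithful action on a field of degree at most 1 inside a rational function field becomes one on
`K(X)`, by Kronecker substitution and Lüroth. -/
theorem exists_hom_ratFunc
    (σ : G →* (FractionRing (MvPolynomial (Fin n) K) ≃ₐ[K] FractionRing (MvPolynomial (Fin n) K)))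
    (E : IntermediateField K (FractionRing (MvPolynomial (Fin n) K)))
    (hstable : ∀ g, ∀ x ∈ E, σ g x ∈ E) (hfaithful : ∀ g, (∀ x ∈ E, σ g x = x) → g = 1)
    (hE : Algebra.trdeg K E ≤ 1) :
    ∃ Θ : G →* (RatFunc K →ₐ[K] RatFunc K), Function.Injective Θ := by
  let L := FractionRing (MvPolynomial (Fin n) K)
  have hx : ∀ g : G, ∃ x ∈ E, g ≠ 1 → σ g x ≠ x := by
    intro g
    by_cases hg : g = 1
    · exact ⟨0, zero_mem E, fun h => absurd hg h⟩
    · by_contra! h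
      exact hg (hfaithful g fun x hx => (h x hx).2)
  choose x hxE hx using hx
  -- The orbits of witnesses `x g` moved by each `g ≠ 1`: a finite set generating a stable subfield
  -- that is still faithful.
  let T : Set L := Set.range fun p : G × G => σ p.1 (x p.2)
  have hTfin : T.Finite := Set.finite_range _
  have hxT : ∀ g, x g ∈ T := fun g => ⟨(1, g), by simp⟩
  have hTE : adjoin K T ≤ E := by
    rw [adjoin_le_iff]
    rintro _ ⟨p, rfl⟩
    exact hstable _ _ (hxE _)
  have hd : Algebra.trdeg K (adjoin K T) ≤ 1 :=
    (trdeg_le_of_injective (inclusion hTE) (inclusion_injective hTE)).trans hE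
  obtain ⟨g₀, hg₀⟩ := exists_ne (1 : G)
  have htr : Transcendental K (x g₀) := by
    intro h
    obtain ⟨r, hr⟩ := mem_range_of_isAlgebraic_fractionRing h
    exact hx g₀ hg₀ (by rw [← hr]; exact (σ g₀).commutes r)
  obtain ⟨ψ⟩ := nonempty_algHom_ratFunc hTfin (hxT g₀) htr hd
  have hstT : ∀ g, ∀ y ∈ adjoin K T, σ g y ∈ adjoin K T := by
    intro g y hy
    have h1 : (adjoin K T).map (σ g : L →ₐ[K] L) ≤ adjoin K T := by
      rw [adjoin_map, adjoin_le_iff]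
      rintro _ ⟨_, ⟨p, rfl⟩, rfl⟩
      exact subset_adjoin K T ⟨(g * p.1, p.2), by simp⟩
    exact h1 ⟨y, hy, rfl⟩
  have hne : ψ.fieldRange ≠ ⊥ := by
    intro h
    have h1 : ψ ⟨x g₀, subset_adjoin K T (hxT g₀)⟩ ∈ ψ.fieldRange := ⟨_, rfl⟩
    rw [h, mem_bot] at h1
    obtain ⟨r, hr⟩ := h1
    rw [← ψ.commutes] at hr
    have h2 : algebraMap K L r = x g₀ := congrArg Subtype.val (ψ.injective hr)
    exact htr (h2 ▸ isAlgebraic_algebraMap r)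
  -- Lüroth: the image of `ψ` is a subfield of `K(X)` larger than `K`, so it is itself isomorphic to
  -- `K(X)`.
  let e : adjoin K T ≃ₐ[K] RatFunc K :=
    (AlgEquiv.ofInjectiveField ψ).trans (RatFunc.Luroth.algEquiv hne).symm
  let τ : G → (adjoin K T →ₐ[K] adjoin K T) := fun g =>
    (((σ g : L →ₐ[K] L).comp (adjoin K T).val).codRestrict (adjoin K T).toSubalgebra
      fun y => hstT g y y.2)
  have hτ : ∀ g y, (τ g y : L) = σ g y := fun _ _ => rfl
  refine ⟨⟨⟨fun g => (e : adjoin K T →ₐ[K] RatFunc K).comp ((τ g).comp e.symm), ?_⟩, ?_⟩, ?_⟩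
  · ext y
    have : τ 1 (e.symm y) = e.symm y := Subtype.ext (by rw [hτ, map_one]; rfl)
    simp [this]
  · intro g h
    ext y
    have : τ (g * h) (e.symm y) = τ g (τ h (e.symm y)) :=
      Subtype.ext (by rw [hτ, hτ, hτ, map_mul]; rfl)
    simp [this]
  · rw [injective_iff_map_eq_one]
    intro g hg
    by_contra hg1
    refine hx g hg1 ?_
    have h1 := DFunLike.congr_fun hg (e ⟨x g, subset_adjoin K T (hxT g)⟩)
    have h2 : e (τ g (e.symm (e ⟨x g, subset_adjoin K T (hxT g)⟩))) =
      e ⟨x g, subset_adjoin K T (hxT g)⟩ := h1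
    rw [AlgEquiv.symm_apply_apply] at h2
    exact congrArg Subtype.val (e.injective h2)

theorem exists_hom_ratFunc_of_funField {V : Type*} [AddCommGroup V] [Module K V]
    [FiniteDimensional K V] (σ : G →* (FunField K V ≃ₐ[K] FunField K V))
    (E : IntermediateField K (FunField K V))
    (hstable : ∀ g, ∀ x ∈ E, σ g x ∈ E) (hfaithful : ∀ g, (∀ x ∈ E, σ g x = x) → g = 1)
    (hE : Algebra.trdeg K E ≤ 1) :
    ∃ Θ : G →* (RatFunc K →ₐ[K] RatFunc K), Function.Injective Θ := by
  obtain ⟨n, ⟨e⟩⟩ := nonempty_funField_equiv (K := K) V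
  refine exists_hom_ratFunc ((AlgEquiv.autCongr e).toMonoidHom.comp σ)
    (E.map (e : FunField K V →ₐ[K] _)) ?_ ?_ ?_
  · rintro g _ ⟨x, hx, rfl⟩
    refine ⟨σ g x, hstable g x hx, ?_⟩
    show e (σ g x) = e (σ g (e.symm (e x)))
    rw [e.symm_apply_apply]
  · intro g hg
    refine hfaithful g fun x hx => e.injective ?_
    have h1 : e (σ g (e.symm (e x))) = e x := hg (e x) ⟨x, hx, rfl⟩
    rwa [e.symm_apply_apply] at h1
  · have h := (E.equivMap (e : FunField K V →ₐ[K] FractionRing (MvPolynomial (Fin n) K))).lift_trdeg_eq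
    have h1 := Cardinal.lift_le.2 hE
    rw [h] at h1
    simpa using h1

/-- The relations satisfied by two double transpositions and a `3`-cycle in `A₄`. -/
theorem alternatingFour_relations : ∃ a b s : alternatingGroup (Fin 4),
    a * a = 1 ∧ b * b = 1 ∧ (b * a) * (b * a) = 1 ∧ a ≠ 1 ∧ b ≠ 1 ∧ b * a ≠ 1 ∧
      b * s = s * a ∧ b * a * s = s * b := by
  refine ⟨⟨Equiv.swap 0 1 * Equiv.swap 2 3, Equiv.Perm.mem_alternatingGroup.2 (by decide)⟩,
    ⟨Equiv.swap 0 2 * Equiv.swap 1 3, Equiv.Perm.mem_alternatingGroup.2 (by decide)⟩,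
    ⟨Equiv.swap 1 2 * Equiv.swap 2 3, Equiv.Perm.mem_alternatingGroup.2 (by decide)⟩, ?_⟩
  decide

end LowerBound

/-- A subfield faithful for `G` is faithful for the copy of `A₄` inside it, so the obstruction for
`A₄` serves `A₅` as well. -/
theorem two_le_trdeg {K G : Type*} [Field K] [Group G] [CharP K 2] (hK : ∀ r : K, r ^ 2 + r + 1 ≠ 0)
    {V : Type*} [AddCommGroup V] [Module K V] [FiniteDimensional K V]
    {ρ : Representation K G V} (f : alternatingGroup (Fin 4) →* G) (hf : Function.Injective f)
    {E : IntermediateField K (FunField K V)} (hE : IsFaithfulSubfield ρ E) :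
    2 ≤ Algebra.trdeg K E := by
  by_contra h
  have h1 : Algebra.trdeg K E ≤ 1 := by
    rw [not_le] at h
    obtain ⟨m, hm⟩ := Cardinal.lt_aleph0.1 (h.trans (Cardinal.natCast_lt_aleph0 (n := 2)))
    rw [hm] at h ⊢
    norm_cast at h ⊢
    omega
  obtain ⟨a, b, s, ha, hb, hba, ha1, hb1, hba1, hs, hs'⟩ := alternatingFour_relations
  obtain ⟨Θ, hΘ⟩ := exists_hom_ratFunc_of_funField ((fieldAut ρ).comp f) E
    (fun g => hE.stable (f g)) (fun g hg => hf ((hE.faithful _ hg).trans (map_one f).symm)) h1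
  obtain ⟨r, hr⟩ := exists_cube_root_of_hom Θ hΘ ha hb hba ha1 hb1 hba1 hs hs'
  exact hK r hr

end EssDim

theorem proposition7p4 {K : Type*} [Field K] [CharP K 2]
    {V : Type*} [AddCommGroup V] [Module K V] [FiniteDimensional K V]
    {W : Type*} [AddCommGroup W] [Module K W] [FiniteDimensional K W]
    (ρ : Representation K (alternatingGroup (Fin 4)) V) (hρ : Function.Injective ρ)
    (τ : Representation K (alternatingGroup (Fin 5)) W) (hτ : Function.Injective τ) :
    (Nonempty (GaloisField 2 2 →+* K) → EssDim.essDim ρ = 1 ∧ EssDim.essDim τ = 1) ∧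
    (¬ Nonempty (GaloisField 2 2 →+* K) → EssDim.essDim ρ = 2 ∧ EssDim.essDim τ = 2) := by
  obtain ⟨π, hπ⟩ := EssDim.exists_alternatingFive_hom
  obtain ⟨f, hf⟩ := EssDim.exists_alternatingFour_hom
  constructor
  · rintro ⟨φ⟩
    constructor
    · simpa using EssDim.essDim_eq 1 (EssDim.exists_faithfulSubfield_trdeg_le_one hρ φ (π.comp f)
        (hπ.comp hf)) fun E hE => by simpa using EssDim.one_le_trdeg hE
    · simpa using EssDim.essDim_eq 1 (EssDim.exists_faithfulSubfield_trdeg_le_one hτ φ π hπ)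
        fun E hE => by simpa using EssDim.one_le_trdeg hE
  · intro hφ
    have hK : ∀ r : K, r ^ 2 + r + 1 ≠ 0 := fun r hr => hφ (EssDim.nonempty_galoisField_hom hr)
    constructor
    · simpa using EssDim.essDim_eq 2 (EssDim.exists_faithfulSubfield_trdeg_le_two hρ hK (π.comp f)
        (hπ.comp hf)) fun E hE => by
          simpa using EssDim.two_le_trdeg hK (MonoidHom.id _) Function.injective_id hE
    · simpa using EssDim.essDim_eq 2 (EssDim.exists_faithfulSubfield_trdeg_le_two hτ hK π hπ)
        fun E hE => by simpa using EssDim.two_le_trdeg hK f hf hE
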